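/- Let $K$ be an arbitrary field, $n \ge 1$, $\mathbb{P}^n = \mathbb{P}^n_K$ and $R = K[x_0,\dots,x_n]$. Given $s \ge 1$ distinct $K$-rational points $P_1,\dots,P_s \in \mathbb{P}^n$ and integers $m_1,\dots,m_s \ge 1$, the fat point scheme $X = \sum_{i=1}^s m_i P_i$ is the subscheme of $\mathbb{P}^n$ with homogeneous ideal $I_X = \bigcap_{i=1}^s I_{P_i}^{m_i}$, where $I_P \subset R$ is the homogeneous ideal of the point $P$. Its degree is $\deg X = \sum_{i=1}^s \binom{n+m_i-1}{n}$, and its regularity index $r(X)$ is the least integer $d$ such that $X$ imposes independent conditions on forms of degree $d$, that is, $\dim_K [R/I_X]_d = \deg X$. The Segre bound of $X$ is $$\operatorname{seg}(X) = \max\left\{ \left\lceil \frac{-1 + \sum_{P_i \in L} m_i}{\dim L} \right\rceil \;\middle|\; L \subseteq \mathbb{P}^n \text{ a positive-dimensional linear subspace} \right\}.$$ **Theorem.** Let $Z \subset \mathbb{P}^n$ be a fat point scheme with $r(Z) \le \operatorname{seg}(Z)$. Then, for every $K$-rational point $P \in \mathbb{P}^n$ that is not in the support of $Z$, one has $r(Z+P)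 \le \operatorname{seg}(Z+P)$. **Corollary.** If $X = P_1 + \dots + P_s$ is the reduced zero-dimensional subscheme of $\mathbb{P}^n$ consisting of any $s \ge 1$ distinct $K$-rational points, then $r(X) \le \operatorname{seg}(X)$. -/

import Mathlib

open scoped LinearAlgebra.Projectivization

/-- A fat point scheme `m₁P₁ + ⋯ + mₛPₛ` in `ℙⁿ` over `K`: a finitely supported function assigning
to each `K`-rational point its multiplicity (positive exactly on the support). Addition of
functions is addition of fat point schemes; `0` is the empty scheme. -/
abbrev FatPointScheme (K : Type*) [Field K] (n : ℕ) : Type _ :=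
  ℙ K (Fin (n + 1) → K) →₀ ℕ

namespace FatPointScheme

variable {K : Type*} [Field K] {n : ℕ}

/-- The homogeneous ideal `I_P` of a point `P`: generated by the forms that vanish at `P`. -/
noncomputable def pointIdeal (P : ℙ K (Fin (n + 1) → K)) : Ideal (MvPolynomial (Fin (n + 1)) K) :=
  Ideal.span {f | (∃ d : ℕ, f.IsHomogeneous d) ∧ ∀ v ∈ P.submodule, MvPolynomial.eval v f = 0}

/-- The homogeneous ideal `I_X = ⋂ᵢ I_{Pᵢ} ^ mᵢ` of `X = ∑ mᵢ Pᵢ`. -/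
noncomputable def ideal (X : FatPointScheme K n) : Ideal (MvPolynomial (Fin (n + 1)) K) :=
  ⨅ P ∈ X.support, pointIdeal P ^ X P

/-- The Hilbert function `h_X(d) = dim_K [R / I_X]_d = dim_K ([R]_d / [I_X]_d)`. -/
noncomputable def hilbertFunction (X : FatPointScheme K n) (d : ℕ) : ℕ :=
  Module.finrank K (MvPolynomial.homogeneousSubmodule (Fin (n + 1)) K d ⧸
    (X.ideal.restrictScalars K).comap
      (MvPolynomial.homogeneousSubmodule (Fin (n + 1)) K d).subtype)

/-- The degree `∑ᵢ binom(n + mᵢ - 1, n)` of `X = ∑ mᵢ Pᵢ`, the number of conditions that vanishing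
on `X` imposes on forms of large degree. -/
def degree (X : FatPointScheme K n) : ℕ :=
  X.sum fun _ m => (n + m - 1).choose n

/-- The regularity index `r(X)`: the least `d` such that `X` imposes independent conditions on forms
of degree `d`, i.e. `h_X(d) = deg X`. The value would be `⊤` if there were no such `d`, so an upper
bound on `r(X)` includes the existence of `d`. -/
noncomputable def regularityIndex (X : FatPointScheme K n) : ℕ∞ :=
  ⨅ d ∈ {d : ℕ | X.hilbertFunction d = X.degree}, (d : ℕ∞)

/-- The dimension of a (non-empty) linear subspace of projective space. -/
noncomputable def projDim (L : Projectivization.Subspace K (Fin (n + 1) → K)) : ℕ :=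
  Module.finrank K L.submodule - 1

open scoped Classical in
/-- The weight `w_L(X) = ∑_{Pᵢ ∈ L} mᵢ`. -/
noncomputable def weight (X : FatPointScheme K n)
    (L : Projectivization.Subspace K (Fin (n + 1) → K)) : ℕ :=
  ∑ P ∈ X.support with P ∈ L, X P

/-- The numbers `⌈(w_L(X) - 1) / dim L⌉` for positive-dimensional linear subspaces `L ⊆ ℙⁿ`. -/
def segreValues (X : FatPointScheme K n) : Set ℤ :=
  {b | ∃ L : Projectivization.Subspace K (Fin (n + 1) → K), 0 < projDim L ∧
    b = ⌈((X.weight L : ℚ) - 1) / (projDim L : ℚ)⌉}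

/-- The Segre bound `seg(X)`, the maximum of the numbers `⌈(w_L(X) - 1) / dim L⌉`. For `n ≥ 1` and
`X` non-empty this maximum exists and is non-negative; see `isGreatest_segreBound`. -/
noncomputable def segreBound (X : FatPointScheme K n) : ℕ :=
  (sSup X.segreValues).toNat

theorem projDim_top : projDim (⊤ : Projectivization.Subspace K (Fin (n + 1) → K)) = n := by
  unfold projDim
  have h : (⊤ : Projectivization.Subspace K (Fin (n + 1) → K)).submodule = ⊤ :=
    map_top Projectivization.Subspace.submodule
  rw [h]
  simp

theorem weight_top (X : FatPointScheme K n) : X.weight ⊤ = ∑ P ∈ X.support, X P := by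
  unfold weight
  congr 1
  ext P
  have h : P ∈ (⊤ : Projectivization.Subspace K (Fin (n + 1) → K)) := by
    rw [← Projectivization.Subspace.span_univ]
    exact Projectivization.Subspace.subset_span _ (Set.mem_univ P)
  simp [h]

theorem weight_le (X : FatPointScheme K n) (L : Projectivization.Subspace K (Fin (n + 1) → K)) :
    X.weight L ≤ ∑ P ∈ X.support, X P := by
  classical
  exact Finset.sum_le_sum_of_subset (Finset.filter_subset _ _)

theorem isGreatest_segreBound (hn : 1 ≤ n) (X : FatPointScheme K n) (hX : X ≠ 0) :
    IsGreatest X.segreValues (X.segreBound : ℤ) := by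
  have hne : X.segreValues.Nonempty := ⟨_, ⊤, by rw [projDim_top]; omega, rfl⟩
  have hbdd : BddAbove X.segreValues := by
    refine ⟨((∑ P ∈ X.support, X P : ℕ) : ℤ), ?_⟩
    rintro b ⟨L, hL, rfl⟩
    have h1 : (1 : ℚ) ≤ (projDim L : ℚ) := by exact_mod_cast hL
    have h2 : (X.weight L : ℚ) ≤ ((∑ P ∈ X.support, X P : ℕ) : ℚ) := by
      exact_mod_cast X.weight_le L
    have h3 : (0 : ℚ) ≤ ((∑ P ∈ X.support, X P : ℕ) : ℚ) := Nat.cast_nonneg _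
    rw [Int.ceil_le, div_le_iff₀ (by linarith)]
    rw [Int.cast_natCast]
    nlinarith
  have hmem : sSup X.segreValues ∈ X.segreValues := Int.csSup_mem hne hbdd
  have hpos : 0 ≤ sSup X.segreValues := by
    refine le_trans ?_ (le_csSup hbdd ⟨⊤, by rw [projDim_top]; omega, rfl⟩)
    have hw : 1 ≤ X.weight ⊤ := by
      rw [weight_top]
      obtain ⟨P, hP⟩ := Finsupp.support_nonempty_iff.mpr hX
      exact (Nat.one_le_iff_ne_zero.mpr (Finsupp.mem_support_iff.mp hP)).trans
        (Finset.single_le_sum (f := fun P => X P) (fun _ _ => Nat.zero_le _) hP)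
    apply Int.ceil_nonneg
    apply div_nonneg _ (Nat.cast_nonneg _)
    have : (1 : ℚ) ≤ (X.weight ⊤ : ℚ) := by exact_mod_cast hw
    linarith
  have heq : (X.segreBound : ℤ) = sSup X.segreValues := Int.toNat_of_nonneg hpos
  rw [heq]
  exact ⟨hmem, fun b hb => le_csSup hbdd hb⟩

end FatPointScheme

/-! Put `b = seg(Z + P)`. Since `seg(Z) ≤ b` and independence of conditions persists in higher
degrees, `Z` imposes independent conditions on forms of degree `b`. It then suffices to find a form
`F` of degree `b` in `I_Z` with `F(P) ≠ 0`: adding a multiple of `F` adjusts the value at `P`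
without disturbing the jets along `Z`.

`F` is a product of `b` linear forms. List every point `Q` of `Z` with `m_Q` copies and project from
`P`, i.e. pass to the quotient by the line of `P`. If the copies split into `b` classes, each
independent in this quotient, then each class lies on a hyperplane that misses `P`. Copies of one
`Q` fall in different classes, so the product vanishes to order `m_Q` at `Q`. Edmonds' theorem gives
the splitting as soon as `|S| ≤ b · rank S` for every subfamily `S`. For the linear subspace `L`
spanned by `S` and `P`, `rank S = dim L`, so `w_L(Z) ≤ b · dim L` is enough, and this is the Segre
bound of `Z + P` on `L` (`exists_form_mem_ideal_eval_ne_zero`).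

The algebraic input is `mem_pointIdeal_pow_iff`, which turns powers of `I_P` into conditions on
Taylor coefficients over any field. The corollary follows by adding points one at a time. -/

/-! ### Independent transversals and partitions into independent sets -/

/-- **Rado's theorem** for vector configurations: a family of finite sets of vectors has a linearly
independent transversal if any `k` of the sets span a subspace of dimension at least `k`. -/
theorem exists_linearIndependent_transversal {K M ι α : Type*} [Field K] [AddCommGroup M]
    [Module K M] [FiniteDimensional K M] [Fintype ι] [DecidableEq ι] [DecidableEq α]
    (w : ι → α → M) (A : ι → Finset α)
    (h : ∀ S : Finset ι,
      S.card ≤ Module.finrank K (⨆ e ∈ S, Submodule.span K (w e '' A e) : Submodule K M)) :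
    ∃ c : ι → α, (∀ e, c e ∈ A e) ∧ LinearIndependent K fun e => w e (c e) := by
  induction hN : ∑ e, (A e).card using Nat.strong_induction_on generalizing A with
  | _ N ih =>
  subst hN
  -- If all sets are singletons the choice is forced, and the hypothesis for the whole index set is
  -- its independence.
  by_cases hA : ∀ e, ∃ a, A e = {a}
  · choose c hc using hA
    refine ⟨c, fun e => by simp [hc], ?_⟩
    rw [linearIndependent_iff_card_le_finrank_span]
    refine (h Finset.univ).trans (Submodule.finrank_mono ?_)
    refine iSup₂_le fun e _ => Submodule.span_mono ?_
    simp [hc]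
  push Not at hA
  obtain ⟨i, hi⟩ := hA
  have hne : (A i).Nonempty := by
    by_contra hempty
    have := h {i}
    simp [Finset.not_nonempty_iff_eq_empty.mp hempty] at this
  obtain ⟨a, ha⟩ := hne
  obtain ⟨b, hb, hab⟩ : ∃ b ∈ A i, b ≠ a := by
    by_contra! hall
    exact hi a (Finset.eq_singleton_iff_unique_mem.mpr ⟨ha, hall⟩)
  -- Either `x` can be discarded from `A i` and induction applies, or some violating subfamily
  -- obstructs this. It must contain `i`, and `S` is what remains of it without `i`.
  have step : ∀ x ∈ A i, (∃ c : ι → α, (∀ e, c e ∈ A e) ∧ LinearIndependent K fun e => w e (c e)) ∨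
      ∃ S : Finset ι, i ∉ S ∧ Module.finrank K ((⨆ e ∈ S, Submodule.span K (w e '' A e)) ⊔
        Submodule.span K (w i '' ((A i).erase x)) : Submodule K M) ≤ S.card := by
    intro x hx
    by_cases hB : ∀ S : Finset ι, S.card ≤ Module.finrank K
        (⨆ e ∈ S, Submodule.span K (w e '' (Function.update A i ((A i).erase x) e)) :
          Submodule K M)
    · left
      obtain ⟨c, hc, hli⟩ := ih _ (Finset.sum_lt_sum (fun e _ => Finset.card_le_card (by
          rcases eq_or_ne e i with rfl | he
          · simpa using Finset.erase_subset _ _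
          · simp [he])) ⟨i, Finset.mem_univ i, by
            simpa using Finset.card_lt_card (Finset.erase_ssubset hx)⟩) _ hB rfl
      refine ⟨c, fun e => ?_, hli⟩
      have := hc e
      rcases eq_or_ne e i with rfl | he
      · exact Finset.erase_subset _ _ (by simpa using this)
      · simpa [he] using this
    · right
      push Not at hB
      obtain ⟨S, hS⟩ := hB
      have hcongr : ∀ T : Finset ι, i ∉ T →
          (⨆ e ∈ T, Submodule.span K (w e '' (Function.update A i ((A i).erase x) e))) =
          ⨆ e ∈ T, Submodule.span K (w e '' A e) := by
        intro T hT
        refine iSup_congr fun e => iSup_congr fun he => ?_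
        rw [Function.update_of_ne (ne_of_mem_of_not_mem he hT)]
      have hiS : i ∈ S := by
        by_contra hiS
        rw [hcongr S hiS] at hS
        exact absurd (h S) (not_le.mpr hS)
      refine ⟨S.erase i, Finset.notMem_erase i S, ?_⟩
      rw [Finset.card_erase_of_mem hiS, ← hcongr _ (Finset.notMem_erase i S)]
      refine Nat.le_sub_one_of_lt (lt_of_eq_of_lt ?_ hS)
      conv_rhs => rw [← Finset.insert_erase hiS, Finset.iSup_insert]
      rw [sup_comm, Function.update_self]
  rcases step a ha with h1 | ⟨S, hiS, hS⟩
  · exact h1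
  rcases step b hb with h1 | ⟨T, hiT, hT⟩
  · exact h1
  -- Both obstructions together contradict the modular law for dimensions: the sum has dimension at
  -- least `|S ∪ T| + 1`, since `a ≠ b` recovers all of `A i`, and the intersection at least `|S ∩
  -- T|`, whereas the two dimensions add up to at most `|S| + |T|`.
  exfalso
  have hsum := Submodule.finrank_sup_add_finrank_inf_eq
    ((⨆ e ∈ S, Submodule.span K (w e '' A e)) ⊔ Submodule.span K (w i '' ((A i).erase a)))
    ((⨆ e ∈ T, Submodule.span K (w e '' A e)) ⊔ Submodule.span K (w i '' ((A i).erase b)))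
  have hsup := (h (insert i (S ∪ T))).trans (Submodule.finrank_mono (t :=
    ((⨆ e ∈ S, Submodule.span K (w e '' A e)) ⊔ Submodule.span K (w i '' ((A i).erase a))) ⊔
    ((⨆ e ∈ T, Submodule.span K (w e '' A e)) ⊔ Submodule.span K (w i '' ((A i).erase b)))) (by
      rw [Finset.iSup_insert, Finset.iSup_union]
      refine sup_le (Submodule.span_le.mpr ?_) (sup_le ?_ ?_)
      · rintro _ ⟨x, hx, rfl⟩
        rcases eq_or_ne x a with rfl | hxa
        · exact Submodule.mem_sup_right (Submodule.mem_sup_right (Submodule.subset_span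
            ⟨x, by simpa [hab.symm] using hx, rfl⟩))
        · exact Submodule.mem_sup_left (Submodule.mem_sup_right (Submodule.subset_span
            ⟨x, by simpa [hxa] using hx, rfl⟩))
      · exact le_sup_left.trans le_sup_left
      · exact le_sup_left.trans le_sup_right))
  have hinf := (h (S ∩ T)).trans (Submodule.finrank_mono (t :=
    ((⨆ e ∈ S, Submodule.span K (w e '' A e)) ⊔ Submodule.span K (w i '' ((A i).erase a))) ⊓
    ((⨆ e ∈ T, Submodule.span K (w e '' A e)) ⊔ Submodule.span K (w i '' ((A i).erase b))))
      (le_inf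
        ((biSup_mono fun e he => (Finset.mem_inter.mp he).1).trans le_sup_left)
        ((biSup_mono fun e he => (Finset.mem_inter.mp he).2).trans le_sup_left)))
  rw [Finset.card_insert_of_notMem (by simp [hiS, hiT])] at hsup
  have := Finset.card_union_add_card_inter S T
  omega

/-- **Edmonds' partition theorem** for vector configurations: if every subfamily `S` spans a space
of dimension at least `|S| / b`, then the family can be coloured with `b` colours such that every
colour class is linearly independent. -/
theorem exists_coloring_linearIndependent {K W ι : Type*} [Field K] [AddCommGroup W]
    [Module K W] [FiniteDimensional K W] [Fintype ι] (b : ℕ) (v : ι → W)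
    (h : ∀ S : Finset ι, S.card ≤ b * Module.finrank K (Submodule.span K (v '' S))) :
    ∃ c : ι → Fin b, ∀ k, LinearIndependent K fun e : {e // c e = k} => v e := by
  classical
  -- The set for `e` consists of the copies of `v e` in the `b` summands of `W ^ b`, so a
  -- transversal is a colouring. The sets indexed by `S` together span `U ^ b`, of dimension `b ·
  -- dim U`.
  obtain ⟨c, -, hc⟩ := exists_linearIndependent_transversal (K := K) (M := Fin b → W)
    (fun e k => Pi.single k (v e)) (fun _ => Finset.univ) (fun S => by
      refine (h S).trans ?_
      set U := Submodule.span K (v '' S)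
      set Y : Submodule K (Fin b → W) := ⨆ e ∈ S, Submodule.span K
        ((fun k => Pi.single k (v e)) '' ((Finset.univ : Finset (Fin b)) : Set (Fin b)))
      have hU : ∀ k, U ≤ Y.comap (LinearMap.single K (fun _ => W) k) := by
        intro k
        refine Submodule.span_le.mpr ?_
        rintro _ ⟨e, he, rfl⟩
        refine (le_iSup₂_of_le (f := fun e (_ : e ∈ S) => Submodule.span K
          ((fun k => Pi.single k (v e)) '' ((Finset.univ : Finset (Fin b)) : Set (Fin b))))
          e he le_rfl) (Submodule.subset_span ⟨k, by simp, rfl⟩)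
      have hle : LinearMap.range (U.subtype.compLeft (Fin b)) ≤ Y := by
        rintro _ ⟨f, rfl⟩
        rw [← Finset.univ_sum_single (U.subtype.compLeft (Fin b) f)]
        exact Submodule.sum_mem _ fun k _ => hU k (f k).2
      refine le_trans (le_of_eq ?_) (Submodule.finrank_mono hle)
      rw [LinearMap.finrank_range_of_inj, Module.finrank_pi_fintype]
      · simp
      · intro f g hfg
        ext k
        exact congrFun hfg k)
  refine ⟨c, fun k => LinearIndependent.of_comp (LinearMap.single K (fun _ => W) k) ?_⟩
  have heq : (LinearMap.single K (fun _ => W) k ∘ fun e : {e // c e = k} => v e) =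
      (fun e => Pi.single (c e) (v e)) ∘ Subtype.val := by
    ext1 ⟨e, rfl⟩
    rfl
  rw [heq]
  exact hc.comp _ Subtype.val_injective

namespace FatPointScheme

open MvPolynomial

variable {K : Type*} [Field K] {n : ℕ}

/-! ### Products of linear forms through `Z` that avoid `P` -/

/-- The linear form `∑ f(eᵢ) xᵢ` attached to a linear functional `f`. -/
noncomputable def linearForm (f : (Fin (n + 1) → K) →ₗ[K] K) : MvPolynomial (Fin (n + 1)) K :=
  ∑ i, C (f (Pi.single i 1)) * X i

theorem isHomogeneous_linearForm (f : (Fin (n + 1) → K) →ₗ[K] K) :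
    (linearForm f).IsHomogeneous 1 :=
  IsHomogeneous.sum _ _ _ fun i _ => (isHomogeneous_X K i).C_mul _

theorem eval_linearForm (f : (Fin (n + 1) → K) →ₗ[K] K) (v : Fin (n + 1) → K) :
    eval v (linearForm f) = f v := by
  conv_rhs => rw [LinearMap.pi_apply_eq_sum_univ f v]
  have h (i : Fin (n + 1)) : (fun j => if i = j then 1 else 0) = (Pi.single i 1 : _ → K) := by
    ext j
    simp [Pi.single_apply, eq_comm]
  simp [linearForm, mul_comm, h]

theorem linearForm_mem_pointIdeal {f : (Fin (n + 1) → K) →ₗ[K] K} {P : ℙ K (Fin (n + 1) → K)}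
    (h : f P.rep = 0) : linearForm f ∈ pointIdeal P := by
  refine Ideal.subset_span ⟨⟨1, isHomogeneous_linearForm f⟩, fun v hv => ?_⟩
  rw [Projectivization.submodule_eq, Submodule.mem_span_singleton] at hv
  obtain ⟨a, rfl⟩ := hv
  rw [eval_linearForm, map_smul, h, smul_zero]

theorem mkQ_rep_ne_zero {P Q : ℙ K (Fin (n + 1) → K)} (h : Q ≠ P) :
    P.submodule.mkQ Q.rep ≠ 0 := by
  intro h0
  rw [Submodule.mkQ_apply, Submodule.Quotient.mk_eq_zero, Projectivization.submodule_eq,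
    Submodule.mem_span_singleton] at h0
  obtain ⟨a, ha⟩ := h0
  apply h
  rw [← Q.mk_rep, ← P.mk_rep, Projectivization.mk_eq_mk_iff']
  exact ⟨a, ha⟩

theorem finrank_map_mkQ (P : ℙ K (Fin (n + 1) → K)) (U : Submodule K (Fin (n + 1) → K))
    (hU : P.submodule ≤ U) :
    Module.finrank K (U.map P.submodule.mkQ) + 1 = Module.finrank K U := by
  have h := (P.submodule.mkQ.domRestrict U).finrank_range_add_finrank_ker
  rwa [LinearMap.range_domRestrict, LinearMap.ker_domRestrict, Submodule.ker_mkQ,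
    (Submodule.comapSubtypeEquivOfLe hU).finrank_eq, P.finrank_submodule] at h

theorem sum_le_weight (Z : FatPointScheme K n)
    (L : Projectivization.Subspace K (Fin (n + 1) → K)) (S : Finset (ℙ K (Fin (n + 1) → K)))
    (hS : ∀ Q ∈ S, Q ∈ L) : ∑ Q ∈ S, Z Q ≤ Z.weight L := by
  classical
  rw [weight, ← Finset.sum_filter_ne_zero]
  refine Finset.sum_le_sum_of_subset fun Q hQ => ?_
  rw [Finset.mem_filter] at hQ ⊢
  exact ⟨Finsupp.mem_support_iff.mpr hQ.2, hS Q hQ.1⟩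

/-- If `w_L(Z) ≤ b · dim L` for all positive-dimensional linear subspaces `L` through `P`, then some
product of `b` linear forms vanishes on `Z` but not at `P`. -/
theorem exists_form_mem_ideal_eval_ne_zero (Z : FatPointScheme K n) {P : ℙ K (Fin (n + 1) → K)}
    (hP : P ∉ Z.support) (b : ℕ)
    (h : ∀ L : Projectivization.Subspace K (Fin (n + 1) → K), P ∈ L → 0 < projDim L →
      Z.weight L ≤ b * projDim L) :
    ∃ F : MvPolynomial (Fin (n + 1)) K, F.IsHomogeneous b ∧ F ∈ Z.ideal ∧ eval P.rep F ≠ 0 := by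
  classical
  let ι := Σ Q : Z.support, Fin (Z Q)
  let v : ι → (Fin (n + 1) → K) := fun e => e.1.1.rep
  have hne : ∀ e : ι, e.1.1 ≠ P := fun e he => hP (he ▸ e.1.2)
  obtain ⟨c, hc⟩ := exists_coloring_linearIndependent (K := K) b (P.submodule.mkQ ∘ v) (by
    intro S
    rcases S.eq_empty_or_nonempty with rfl | ⟨e₀, he₀⟩
    · simp
    let U : Submodule K (Fin (n + 1) → K) := Submodule.span K (v '' S) ⊔ P.submodule
    have hmap : Submodule.span K (P.submodule.mkQ ∘ v '' S) = U.map P.submodule.mkQ := by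
      rw [Submodule.map_sup, Submodule.map_span, Set.image_comp, P.submodule.mkQ_map_self,
        sup_bot_eq]
    have hrank := finrank_map_mkQ P U le_sup_right
    -- The dimension lost by projecting from `P` is the `1` subtracted in `projDim`.
    have hproj : projDim U.projectivization = Module.finrank K (U.map P.submodule.mkQ) := by
      rw [projDim, Submodule.projectivization, OrderIso.apply_symm_apply, ← hrank,
        Nat.add_sub_cancel]
    have hpos : 0 < projDim U.projectivization := by
      rw [hproj]
      have : Nontrivial (U.map P.submodule.mkQ) := by
        rw [Submodule.nontrivial_iff_ne_bot, ← hmap]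
        intro hbot
        rw [Submodule.span_eq_bot] at hbot
        exact mkQ_rep_ne_zero (hne e₀) (hbot _ ⟨e₀, he₀, rfl⟩)
      exact Module.finrank_pos
    rw [hmap, ← hproj]
    refine le_trans ?_ (h U.projectivization ?_ hpos)
    · have h1 : S ⊆ (S.image Sigma.fst).sigma fun Q => (Finset.univ : Finset (Fin (Z Q))) :=
        fun e he => Finset.mem_sigma.mpr ⟨Finset.mem_image_of_mem _ he, Finset.mem_univ _⟩
      refine (Finset.card_le_card h1).trans ?_
      rw [Finset.card_sigma]
      simp only [Finset.card_univ, Fintype.card_fin]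
      rw [← Finset.sum_image (s := S.image Sigma.fst) (g := Subtype.val) (f := fun Q => Z Q)
        Subtype.val_injective.injOn]
      refine Z.sum_le_weight _ _ fun Q hQ => ?_
      simp only [Finset.mem_image] at hQ
      obtain ⟨_, ⟨e, he, rfl⟩, rfl⟩ := hQ
      rw [Submodule.mem_projectivization_iff_submodule_le, Projectivization.submodule_eq,
        Submodule.span_singleton_le_iff_mem]
      exact Submodule.mem_sup_left (Submodule.subset_span ⟨e, he, rfl⟩)
    · rw [Submodule.mem_projectivization_iff_submodule_le]
      exact le_sup_right)
  have hf : ∀ k, ∃ f : (Fin (n + 1) → K) →ₗ[K] K, f P.rep ≠ 0 ∧ ∀ e, c e = k → f (v e) = 0 := by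
    intro k
    -- Independence modulo the line of `P` makes the span of the class meet that line trivially.
    have hdis := Submodule.range_ker_disjoint (v := fun e : {e // c e = k} => v e) (hc k)
    rw [Submodule.ker_mkQ] at hdis
    have hPmem : P.rep ∉ Submodule.span K (Set.range fun e : {e // c e = k} => v e) := fun hmem =>
      P.rep_nonzero (Submodule.disjoint_def.mp hdis _ hmem (by
        rw [Projectivization.submodule_eq]; exact Submodule.mem_span_singleton_self _))
    obtain ⟨f, hf, hle⟩ := Submodule.exists_le_ker_of_notMem hPmem
    exact ⟨f, hf, fun e he => hle (Submodule.subset_span ⟨⟨e, he⟩, rfl⟩)⟩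
  choose f hfP hfv using hf
  refine ⟨∏ k, linearForm (f k), ?_, ?_, ?_⟩
  · simpa using IsHomogeneous.prod Finset.univ _ (fun _ => 1)
      fun k _ => isHomogeneous_linearForm (f k)
  · simp only [ideal, Submodule.mem_iInf]
    intro Q hQ
    -- Equal vectors cannot occur twice in an independent family, so the `Z Q` copies of `Q` have
    -- distinct colours and contribute `Z Q` distinct factors.
    have hinj : Function.Injective fun t : Fin (Z Q) => c ⟨⟨Q, hQ⟩, t⟩ := by
      intro t t' htt
      have := (hc (c ⟨⟨Q, hQ⟩, t'⟩)).injective (a₁ := ⟨⟨⟨Q, hQ⟩, t⟩, htt⟩)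
        (a₂ := ⟨⟨⟨Q, hQ⟩, t'⟩, rfl⟩) rfl
      exact eq_of_heq (Sigma.mk.inj (congrArg Subtype.val this)).2
    have hmem : ∏ k ∈ Finset.univ.image (fun t : Fin (Z Q) => c ⟨⟨Q, hQ⟩, t⟩), linearForm (f k) ∈
        pointIdeal Q ^ Z Q := by
      rw [Finset.prod_image hinj.injOn]
      have := Ideal.prod_mem_prod (s := (Finset.univ : Finset (Fin (Z Q))))
        (I := fun _ => pointIdeal Q) (x := fun t => linearForm (f (c ⟨⟨Q, hQ⟩, t⟩)))
        fun t _ => linearForm_mem_pointIdeal (hfv _ ⟨⟨Q, hQ⟩, t⟩ rfl)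
      simpa using this
    rw [← Finset.prod_sdiff (Finset.subset_univ
      (Finset.univ.image (fun t : Fin (Z Q) => c ⟨⟨Q, hQ⟩, t⟩)))]
    exact Ideal.mul_mem_left _ _ hmem
  · rw [map_prod, Finset.prod_ne_zero_iff]
    intro k _
    rw [eval_linearForm]
    exact hfP k

/-! ### Powers of point ideals and Taylor coefficients -/

/-- The index of a coordinate that does not vanish at `P`. -/
noncomputable def pivot (P : ℙ K (Fin (n + 1) → K)) : Fin (n + 1) :=
  (Function.ne_iff.mp P.rep_nonzero).choose

theorem rep_pivot_ne_zero (P : ℙ K (Fin (n + 1) → K)) : P.rep (pivot P) ≠ 0 :=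
  (Function.ne_iff.mp P.rep_nonzero).choose_spec

/-- The representative of `P` whose pivot coordinate is `1`. -/
noncomputable def affineRep (P : ℙ K (Fin (n + 1) → K)) : Fin (n + 1) → K :=
  (P.rep (pivot P))⁻¹ • P.rep

theorem affineRep_pivot (P : ℙ K (Fin (n + 1) → K)) : affineRep P (pivot P) = 1 := by
  simp [affineRep, rep_pivot_ne_zero]

theorem affineRep_mem (P : ℙ K (Fin (n + 1) → K)) : affineRep P ∈ P.submodule := by
  rw [Projectivization.submodule_eq]
  exact Submodule.smul_mem _ _ (Submodule.mem_span_singleton_self _)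

theorem mem_submodule_iff_exists_smul (P : ℙ K (Fin (n + 1) → K)) (v : Fin (n + 1) → K) :
    v ∈ P.submodule ↔ ∃ a : K, a • affineRep P = v := by
  constructor
  · intro hv
    rw [Projectivization.submodule_eq, Submodule.mem_span_singleton] at hv
    obtain ⟨a, rfl⟩ := hv
    exact ⟨a * P.rep (pivot P), by simp [affineRep, smul_smul, rep_pivot_ne_zero]⟩
  · rintro ⟨a, rfl⟩
    exact Submodule.smul_mem _ _ (affineRep_mem P)

/-- The expansion of a polynomial in affine coordinates centred at `P`. -/
noncomputable def expansion (P : ℙ K (Fin (n + 1) → K)) :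
    MvPolynomial (Fin (n + 1)) K →ₐ[K] MvPolynomial (Fin n) K :=
  aeval ((pivot P).insertNth (α := fun _ => MvPolynomial (Fin n) K) 1
    fun i => X i + C (affineRep P ((pivot P).succAbove i)))

@[simp]
theorem expansion_X_pivot (P : ℙ K (Fin (n + 1) → K)) : expansion P (X (pivot P)) = 1 := by
  simp [expansion]

@[simp]
theorem expansion_X_succAbove (P : ℙ K (Fin (n + 1) → K)) (i : Fin n) :
    expansion P (X ((pivot P).succAbove i)) = X i + C (affineRep P ((pivot P).succAbove i)) := by
  simp [expansion]

theorem algHom_ext_succAbove {A : Type*} [CommSemiring A] [Algebra K A] (j : Fin (n + 1))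
    {f g : MvPolynomial (Fin (n + 1)) K →ₐ[K] A} (hj : f (X j) = g (X j))
    (h : ∀ i : Fin n, f (X (j.succAbove i)) = g (X (j.succAbove i))) : f = g :=
  MvPolynomial.algHom_ext fun k => by
    rcases Fin.eq_self_or_eq_succAbove j k with rfl | ⟨i, rfl⟩
    exacts [hj, h i]

theorem coeff_zero_expansion (P : ℙ K (Fin (n + 1) → K)) (f : MvPolynomial (Fin (n + 1)) K) :
    coeff 0 (expansion P f) = eval (affineRep P) f := by
  have h : (aeval (0 : Fin n → K)).comp (expansion P) = aeval (affineRep P) :=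
    algHom_ext_succAbove (pivot P) (by simp [affineRep_pivot]) (by simp)
  have := DFunLike.congr_fun h f
  simpa [constantCoeff_eq, aeval_eq_eval] using this

theorem expansion_mem_of_mem_pointIdeal_pow {P : ℙ K (Fin (n + 1) → K)} {m : ℕ}
    {f : MvPolynomial (Fin (n + 1)) K} (hf : f ∈ pointIdeal P ^ m) :
    expansion P f ∈ idealOfVars (Fin n) K ^ m := by
  have h : pointIdeal P ≤ (idealOfVars (Fin n) K).comap (expansion P) := by
    refine Ideal.span_le.mpr ?_
    rintro g ⟨-, hg⟩
    rw [SetLike.mem_coe, Ideal.mem_comap, ← pow_one (idealOfVars (Fin n) K),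
      mem_pow_idealOfVars_iff']
    intro a ha
    obtain rfl : a = 0 := (Finsupp.degree_eq_zero_iff a).mp (by simpa using ha)
    rw [coeff_zero_expansion]
    exact hg _ (affineRep_mem P)
  exact Ideal.le_comap_pow _ m (Ideal.pow_right_mono h m hf)

/-- The substitution `xⱼ ↦ xⱼ`, `xᵢ ↦ xᵢ + t vᵢ xⱼ` for `i ≠ j`, where `j` is the pivot of `P` and
`v` its affine representative. -/
noncomputable def shear (P : ℙ K (Fin (n + 1) → K)) (t : K) :
    MvPolynomial (Fin (n + 1)) K →ₐ[K] MvPolynomial (Fin (n + 1)) K :=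
  aeval ((pivot P).insertNth (α := fun _ => MvPolynomial (Fin (n + 1)) K) (X (pivot P))
    fun i => X ((pivot P).succAbove i) + C (t * affineRep P ((pivot P).succAbove i)) * X (pivot P))

@[simp]
theorem shear_X_pivot (P : ℙ K (Fin (n + 1) → K)) (t : K) :
    shear P t (X (pivot P)) = X (pivot P) := by
  simp [shear]

@[simp]
theorem shear_X_succAbove (P : ℙ K (Fin (n + 1) → K)) (t : K) (i : Fin n) :
    shear P t (X ((pivot P).succAbove i)) = X ((pivot P).succAbove i) +
      C (t * affineRep P ((pivot P).succAbove i)) * X (pivot P) := by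
  simp [shear]

theorem isHomogeneous_shear (P : ℙ K (Fin (n + 1) → K)) (t : K)
    {f : MvPolynomial (Fin (n + 1)) K} {d : ℕ} (hf : f.IsHomogeneous d) :
    (shear P t f).IsHomogeneous d := by
  rw [← one_mul d]
  refine hf.aeval _ fun k => ?_
  rcases Fin.eq_self_or_eq_succAbove (pivot P) k with rfl | ⟨i, rfl⟩
  · rw [Fin.insertNth_apply_same]
    exact isHomogeneous_X K _
  · rw [Fin.insertNth_apply_succAbove]
    exact (isHomogeneous_X K _).add ((isHomogeneous_X K _).C_mul _)

theorem shear_neg_one_shear_one (P : ℙ K (Fin (n + 1) → K)) (f : MvPolynomial (Fin (n + 1)) K) :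
    shear P (-1) (shear P 1 f) = f := by
  have h : (shear P (-1)).comp (shear P 1) = AlgHom.id K _ :=
    algHom_ext_succAbove (pivot P) (by simp) fun i => by
      rw [AlgHom.comp_apply, shear_X_succAbove, map_add, map_mul, shear_X_pivot, shear_X_succAbove,
        ← algebraMap_eq, AlgHom.commutes, algebraMap_eq, neg_one_mul, one_mul, C_neg,
        AlgHom.id_apply]
      ring
  exact DFunLike.congr_fun h f

/-- Setting `xⱼ = 1`. -/
noncomputable def dehomogenize (j : Fin (n + 1)) :
    MvPolynomial (Fin (n + 1)) K →ₐ[K] MvPolynomial (Fin n) K :=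
  aeval (j.insertNth (α := fun _ => MvPolynomial (Fin n) K) 1 X)

theorem dehomogenize_shear_one (P : ℙ K (Fin (n + 1) → K)) (f : MvPolynomial (Fin (n + 1)) K) :
    dehomogenize (pivot P) (shear P 1 f) = expansion P f := by
  have h : (dehomogenize (pivot P)).comp (shear P 1) = expansion P :=
    algHom_ext_succAbove (pivot P) (by simp [dehomogenize])
      (by simp [dehomogenize, ← algebraMap_eq])
  exact DFunLike.congr_fun h f

/-- The exponent of the `xⱼ`-free part of a monomial. -/
noncomputable def dropExponent (j : Fin (n + 1)) (s : Fin (n + 1) →₀ ℕ) : Fin n →₀ ℕ :=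
  s.comapDomain j.succAbove j.succAbove_right_injective.injOn

theorem degree_eq_add_degree_dropExponent (j : Fin (n + 1)) (s : Fin (n + 1) →₀ ℕ) :
    s.degree = s j + (dropExponent j s).degree := by
  rw [Finsupp.degree_eq_sum, Finsupp.degree_eq_sum, Fin.sum_univ_succAbove _ j]
  rfl

/-- The total degree recovers the exponent of `xⱼ`, so setting `xⱼ = 1` merges no monomials of a
form. -/
theorem eq_of_dropExponent_eq {j : Fin (n + 1)} {s t : Fin (n + 1) →₀ ℕ}
    (hd : s.degree = t.degree) (h : dropExponent j s = dropExponent j t) : s = t := by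
  rw [degree_eq_add_degree_dropExponent j, degree_eq_add_degree_dropExponent j t, h] at hd
  ext k
  rcases Fin.eq_self_or_eq_succAbove j k with rfl | ⟨i, rfl⟩
  · omega
  · exact DFunLike.congr_fun h i

theorem dehomogenize_monomial (j : Fin (n + 1)) (s : Fin (n + 1) →₀ ℕ) (c : K) :
    dehomogenize j (monomial s c) = monomial (dropExponent j s) c := by
  rw [dehomogenize, aeval_monomial, Finsupp.prod_fintype _ _ (by simp), Fin.prod_univ_succAbove _ j,
    monomial_eq, Finsupp.prod_fintype _ _ (by simp)]
  simp [dropExponent, algebraMap_eq]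

theorem coeff_dehomogenize {g : MvPolynomial (Fin (n + 1)) K} {d : ℕ} (hg : g.IsHomogeneous d)
    (j : Fin (n + 1)) {s : Fin (n + 1) →₀ ℕ} (hs : s.degree = d) :
    coeff (dropExponent j s) (dehomogenize j g) = coeff s g := by
  classical
  conv_lhs => rw [g.as_sum, map_sum]
  simp only [dehomogenize_monomial, coeff_sum, coeff_monomial]
  rw [Finset.sum_eq_single s]
  · simp
  · intro t ht hts
    rw [if_neg]
    intro h
    refine hts (eq_of_dropExponent_eq ?_ h)
    by_contra hne
    exact mem_support_iff.mp ht (hg.coeff_eq_zero (by omega))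
  · intro hs'
    simpa using hs'

theorem shear_X_succAbove_mem (P : ℙ K (Fin (n + 1) → K)) (i : Fin n) :
    shear P (-1) (X ((pivot P).succAbove i)) ∈ pointIdeal P := by
  refine Ideal.subset_span ⟨⟨1, isHomogeneous_shear P _ (isHomogeneous_X K _)⟩, fun v hv => ?_⟩
  obtain ⟨a, rfl⟩ := (mem_submodule_iff_exists_smul P v).mp hv
  simp [affineRep_pivot]
  ring

theorem shear_monomial_mem (P : ℙ K (Fin (n + 1) → K)) (s : Fin (n + 1) →₀ ℕ) (c : K) :
    shear P (-1) (monomial s c) ∈ pointIdeal P ^ (dropExponent (pivot P) s).degree := by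
  rw [monomial_eq, map_mul, Finsupp.prod_fintype _ _ (by simp),
    Fin.prod_univ_succAbove _ (pivot P), map_mul, map_prod, Finsupp.degree_eq_sum,
    ← Finset.prod_pow_eq_pow_sum]
  refine Ideal.mul_mem_left _ _ (Ideal.mul_mem_left _ _ (Ideal.prod_mem_prod fun i _ => ?_))
  rw [map_pow]
  exact Ideal.pow_mem_pow (shear_X_succAbove_mem P i) _

/-- A form lies in `I_P ^ m` if and only if its expansion at `P` vanishes to order `m`. -/
theorem mem_pointIdeal_pow_iff {P : ℙ K (Fin (n + 1) → K)} {m d : ℕ}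
    {f : MvPolynomial (Fin (n + 1)) K} (hf : f.IsHomogeneous d) :
    f ∈ pointIdeal P ^ m ↔ ∀ a : Fin n →₀ ℕ, a.degree < m → coeff a (expansion P f) = 0 := by
  rw [← mem_pow_idealOfVars_iff']
  refine ⟨expansion_mem_of_mem_pointIdeal_pow, fun h => ?_⟩
  have hg := isHomogeneous_shear P 1 hf
  -- The shear moves `P` to a coordinate point, where the order of vanishing is read off monomial by
  -- monomial. Shearing back sends each variable other than the pivot into `I_P`.
  rw [← shear_neg_one_shear_one P f, (shear P 1 f).as_sum, map_sum]
  refine Ideal.sum_mem _ fun s hs => ?_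
  refine Ideal.pow_le_pow_right ?_ (shear_monomial_mem P s _)
  rw [mem_pow_idealOfVars_iff] at h
  apply h
  have hsd : s.degree = d := by
    by_contra hne
    exact mem_support_iff.mp hs (hg.coeff_eq_zero hne)
  rw [mem_support_iff, ← dehomogenize_shear_one, coeff_dehomogenize hg _ hsd]
  exact mem_support_iff.mp hs

theorem eval_rep_eq_zero_of_mem_pointIdeal {P : ℙ K (Fin (n + 1) → K)}
    {f : MvPolynomial (Fin (n + 1)) K} (hf : f ∈ pointIdeal P) : eval P.rep f = 0 := by
  have h : pointIdeal P ≤ RingHom.ker (eval P.rep) := Ideal.span_le.mpr fun g hg => hg.2 _ (by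
    rw [Projectivization.submodule_eq]
    exact Submodule.mem_span_singleton_self _)
  exact h hf

/-! ### Jets and independent conditions -/

/-- The exponents of degree less than `m`. -/
noncomputable def lowExponents (n m : ℕ) : Finset (Fin n →₀ ℕ) :=
  (Finset.range m).biUnion fun k => Finset.univ.finsuppAntidiag k

theorem mem_lowExponents {m : ℕ} {a : Fin n →₀ ℕ} : a ∈ lowExponents n m ↔ a.degree < m := by
  simp [lowExponents, Finsupp.degree_eq_sum]

theorem card_lowExponents (hn : 1 ≤ n) (m : ℕ) :
    (lowExponents n m).card = (n + m - 1).choose n := by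
  rw [lowExponents, Finset.card_biUnion]
  · simp only [Finset.card_finsuppAntidiag_nat_eq_multichoose, Finset.card_univ, Fintype.card_fin]
    cases m with
    -- Here `n ≥ 1` matters: with truncated subtraction the binomial coefficient for `n = m = 0`
    -- would be `1`.
    | zero => simp [Nat.choose_eq_zero_of_lt (show n - 1 < n by omega)]
    | succ m => rw [Nat.sum_range_multichoose, Nat.add_comm m n]; rfl
  · intro k _ l _ hkl
    rw [Function.onFun, Finset.disjoint_left]
    intro a ha hb
    rw [Finset.mem_finsuppAntidiag] at ha hb
    exact hkl (ha.1.symm.trans hb.1)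

/-- The Taylor coefficients of order less than `X P` at the points `P` of `X`. -/
noncomputable def jets (X : FatPointScheme K n) : MvPolynomial (Fin (n + 1)) K →ₗ[K]
    ((Σ P : X.support, lowExponents n (X P)) → K) :=
  LinearMap.pi fun p => lcoeff K p.2.1 ∘ₗ (expansion p.1.1).toLinearMap

theorem mem_ideal_iff {X : FatPointScheme K n} {d : ℕ} {f : MvPolynomial (Fin (n + 1)) K}
    (hf : f.IsHomogeneous d) : f ∈ X.ideal ↔ X.jets f = 0 := by
  simp only [ideal, Submodule.mem_iInf, mem_pointIdeal_pow_iff hf]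
  constructor
  · intro h
    ext ⟨⟨P, hP⟩, a, ha⟩
    exact h P hP a (mem_lowExponents.mp ha)
  · intro h P hP a ha
    exact congrFun h ⟨⟨P, hP⟩, a, mem_lowExponents.mpr ha⟩

theorem hilbertFunction_eq_finrank_range (X : FatPointScheme K n) (d : ℕ) :
    X.hilbertFunction d = Module.finrank K
      (LinearMap.range (X.jets.domRestrict (homogeneousSubmodule (Fin (n + 1)) K d))) := by
  rw [hilbertFunction, ← (LinearMap.quotKerEquivRange _).finrank_eq]
  have : (X.ideal.restrictScalars K).comap (homogeneousSubmodule (Fin (n + 1)) K d).subtype =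
      LinearMap.ker (X.jets.domRestrict (homogeneousSubmodule (Fin (n + 1)) K d)) := by
    ext ⟨f, hf⟩
    exact mem_ideal_iff hf
  rw [this]

theorem degree_eq_card (hn : 1 ≤ n) (X : FatPointScheme K n) :
    X.degree = Fintype.card (Σ P : X.support, lowExponents n (X P)) := by
  simp only [Fintype.card_sigma, Fintype.card_coe, card_lowExponents hn, degree, Finsupp.sum]
  exact (Finset.sum_coe_sort X.support fun P => (n + X P - 1).choose n).symm

/-- `X` imposes independent conditions on forms of degree `d`, i.e. the Taylor coefficients of such
forms at the points of `X` can be prescribed arbitrarily. -/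
def ImposesIndependentConditions (X : FatPointScheme K n) (d : ℕ) : Prop :=
  ∀ t : ℙ K (Fin (n + 1) → K) → (Fin n →₀ ℕ) → K, ∃ f : MvPolynomial (Fin (n + 1)) K,
    f.IsHomogeneous d ∧ ∀ P a, a.degree < X P → coeff a (expansion P f) = t P a

theorem hilbertFunction_eq_degree_iff (hn : 1 ≤ n) (X : FatPointScheme K n) (d : ℕ) :
    X.hilbertFunction d = X.degree ↔ X.ImposesIndependentConditions d := by
  rw [hilbertFunction_eq_finrank_range, degree_eq_card hn,
    ← Module.finrank_fintype_fun_eq_card (R := K)]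
  constructor
  · intro h t
    have htop := Submodule.eq_top_of_finrank_eq h
    obtain ⟨⟨f, hf⟩, hft⟩ := LinearMap.range_eq_top.mp htop fun p => t p.1.1 p.2.1
    refine ⟨f, hf, fun P a ha => ?_⟩
    have hP : P ∈ X.support := Finsupp.mem_support_iff.mpr (by omega)
    exact congrFun hft ⟨⟨P, hP⟩, a, mem_lowExponents.mpr ha⟩
  · intro h
    classical
    rw [LinearMap.range_eq_top.mpr, finrank_top]
    intro t
    obtain ⟨f, hf, hft⟩ := h fun P a =>
      if hP : P ∈ X.support then
        if ha : a ∈ lowExponents n (X P) then t ⟨⟨P, hP⟩, a, ha⟩ else 0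
      else 0
    refine ⟨⟨f, hf⟩, funext fun ⟨⟨P, hP⟩, a, ha⟩ => ?_⟩
    have := hft P a (mem_lowExponents.mp ha)
    rw [dif_pos hP, dif_pos ha] at this
    exact this

/-- Over a finite field a linear form missing all points of `X` may not exist. The prescribed jets
are therefore split into pieces supported at single points `P`, and each piece is multiplied by the
pivot variable of `P`, whose expansion at `P` is `1`. At the other points the piece still vanishes
to the required order. -/
theorem ImposesIndependentConditions.succ {X : FatPointScheme K n} {d : ℕ}
    (h : X.ImposesIndependentConditions d) : X.ImposesIndependentConditions (d + 1) := by
  classical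
  intro t
  choose F hF hFt using fun P => h fun Q a => if Q = P then t Q a else 0
  refine ⟨∑ P ∈ X.support, F P * MvPolynomial.X (pivot P), IsHomogeneous.sum _ _ _ fun P _ =>
    (hF P).mul (isHomogeneous_X K _), fun Q a ha => ?_⟩
  have hQ : Q ∈ X.support := Finsupp.mem_support_iff.mpr (by omega)
  rw [map_sum, coeff_sum, Finset.sum_eq_single_of_mem Q hQ]
  · rw [map_mul, expansion_X_pivot, mul_one, hFt Q Q a ha, if_pos rfl]
  · intro P _ hPQ
    have hmem : expansion Q (F P) ∈ idealOfVars (Fin n) K ^ X Q := by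
      rw [mem_pow_idealOfVars_iff']
      intro a ha
      rw [hFt P Q a ha, if_neg hPQ.symm]
    rw [map_mul]
    exact (mem_pow_idealOfVars_iff' _ _).mp (Ideal.mul_mem_right _ _ hmem) a ha

theorem ImposesIndependentConditions.mono {X : FatPointScheme K n} {d e : ℕ} (hde : d ≤ e)
    (h : X.ImposesIndependentConditions d) : X.ImposesIndependentConditions e := by
  induction e, hde using Nat.le_induction with
  | base => exact h
  | succ e _ ih => exact ih.succ

/-- A bound on the infimum gives independence only in some degree at most `b`; persistence carries
it up to `b`. -/
theorem regularityIndex_le_iff (hn : 1 ≤ n) (X : FatPointScheme K n) (b : ℕ) :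
    X.regularityIndex ≤ b ↔ X.ImposesIndependentConditions b := by
  constructor
  · intro h
    by_contra hb
    have : ((b + 1 : ℕ) : ℕ∞) ≤ X.regularityIndex := by
      refine le_iInf₂ fun d hd => ?_
      rw [Nat.cast_le]
      by_contra hlt
      exact hb (((hilbertFunction_eq_degree_iff hn X d).mp hd).mono (by omega))
    exact absurd (Nat.cast_le.mp (this.trans h)) (by omega)
  · intro h
    exact iInf₂_le b ((hilbertFunction_eq_degree_iff hn X b).mpr h)

theorem ImposesIndependentConditions.add_single {Z : FatPointScheme K n} {b : ℕ}
    (h : Z.ImposesIndependentConditions b) {P : ℙ K (Fin (n + 1) → K)} (hP : P ∉ Z.support)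
    {F : MvPolynomial (Fin (n + 1)) K} (hF : F.IsHomogeneous b) (hFZ : F ∈ Z.ideal)
    (hFP : eval P.rep F ≠ 0) :
    ImposesIndependentConditions (Z + Finsupp.single P 1) b := by
  intro t
  obtain ⟨f, hf, hft⟩ := h t
  -- The constant term is the value at `affineRep P`, not at `P.rep`; membership in `I_P` links the
  -- two.
  have hFP' : coeff 0 (expansion P F) ≠ 0 := by
    rw [coeff_zero_expansion]
    intro h0
    apply hFP
    refine eval_rep_eq_zero_of_mem_pointIdeal ?_
    rw [← pow_one (pointIdeal P), mem_pointIdeal_pow_iff hF]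
    intro a ha
    obtain rfl : a = 0 := (Finsupp.degree_eq_zero_iff a).mp (by simpa using ha)
    rwa [coeff_zero_expansion]
  refine ⟨f + C ((t P 0 - coeff 0 (expansion P f)) / coeff 0 (expansion P F)) * F,
    hf.add (hF.C_mul _), fun Q a ha => ?_⟩
  rw [map_add, map_mul, coeff_add, ← algebraMap_eq, AlgHom.commutes, algebraMap_eq, coeff_C_mul]
  rcases eq_or_ne Q P with rfl | hQ
  · have hZ : Z Q = 0 := Finsupp.notMem_support_iff.mp hP
    obtain rfl : a = 0 := (Finsupp.degree_eq_zero_iff a).mp (by simpa [hZ] using ha)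
    rw [div_mul_cancel₀ _ hFP']
    ring
  · have ha' : a.degree < Z Q := by simpa [hQ.symm] using ha
    have hQs : Q ∈ Z.support := Finsupp.mem_support_iff.mpr (by omega)
    have hz : coeff a (expansion Q F) = 0 :=
      congrFun ((mem_ideal_iff hF).mp hFZ) ⟨⟨Q, hQs⟩, a, mem_lowExponents.mpr ha'⟩
    rw [hz, mul_zero, add_zero, hft Q a ha']

/-! ### Segre bounds and adding a simple point -/

theorem weight_mono {X Y : FatPointScheme K n} (h : X ≤ Y)
    (L : Projectivization.Subspace K (Fin (n + 1) → K)) : X.weight L ≤ Y.weight L := by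
  classical
  unfold weight
  exact (Finset.sum_le_sum fun P _ => h P).trans (Finset.sum_le_sum_of_subset
    (Finset.filter_subset_filter _ (Finsupp.support_mono h)))

theorem segreBound_mono (hn : 1 ≤ n) {X Y : FatPointScheme K n} (hX : X ≠ 0) (h : X ≤ Y) :
    X.segreBound ≤ Y.segreBound := by
  have hY : Y ≠ 0 := by
    rintro rfl
    exact hX (le_antisymm h (zero_le))
  obtain ⟨L, hL, hXL⟩ := (isGreatest_segreBound hn X hX).1
  have h1 := (isGreatest_segreBound hn Y hY).2 ⟨L, hL, rfl⟩
  have h2 : (X.segreBound : ℤ) ≤ Y.segreBound := by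
    rw [hXL]
    refine le_trans (Int.ceil_mono ?_) h1
    have := X.weight_mono h L
    gcongr
  exact_mod_cast h2

theorem weight_add_single {Z : FatPointScheme K n} {P : ℙ K (Fin (n + 1) → K)} 
    (L : Projectivization.Subspace K (Fin (n + 1) → K)) (hPL : P ∈ L) (hP : P ∉ Z.support) :
    Z.weight L + 1 ≤ weight (Z + Finsupp.single P 1) L := by
  classical
  have hs : P ∉ Z.support.filter (· ∈ L) := fun h => hP (Finset.mem_filter.mp h).1
  refine le_trans (le_of_eq ?_) (sum_le_weight _ L (insert P (Z.support.filter (· ∈ L))) ?_)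
  · rw [Finset.sum_insert hs, weight, add_comm]
    congr 1
    · simp [Finsupp.notMem_support_iff.mp hP]
    · refine Finset.sum_congr (by congr) fun Q hQ => ?_
      have : P ≠ Q := fun h => hs (h ▸ hQ)
      simp [this]
  · intro Q hQ
    rcases Finset.mem_insert.mp hQ with rfl | hQ
    · exact hPL
    · exact (Finset.mem_filter.mp hQ).2

/-- Adding a simple point to a scheme that imposes independent conditions on forms of degree
`seg(Z + P)` gives a scheme with the same property. -/
theorem ImposesIndependentConditions.add_single_segreBound (hn : 1 ≤ n) {Z : FatPointScheme K n}
    {P : ℙ K (Fin (n + 1) → K)} (hP : P ∉ Z.support)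
    (h : Z.ImposesIndependentConditions (segreBound (Z + Finsupp.single P 1))) :
    ImposesIndependentConditions (Z + Finsupp.single P 1)
      (segreBound (Z + Finsupp.single P 1)) := by
  have hne : Z + Finsupp.single P 1 ≠ 0 := fun h0 => by
    simpa using DFunLike.congr_fun h0 P
  obtain ⟨F, hF, hFZ, hFP⟩ := Z.exists_form_mem_ideal_eval_ne_zero hP
    (segreBound (Z + Finsupp.single P 1)) (fun L hPL hL => by
      -- The `-1` in the Segre bound cancels the contribution of `P` to the weight of `L`.
      have h1 := (isGreatest_segreBound hn _ hne).2 ⟨L, hL, rfl⟩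
      have h2 := Z.weight_add_single L hPL hP
      have h3 : (0 : ℚ) < projDim L := by exact_mod_cast hL
      rw [Int.ceil_le, div_le_iff₀ h3] at h1
      have h4 : (Z.weight L : ℚ) + 1 ≤ weight (Z + Finsupp.single P 1) L := by exact_mod_cast h2
      have h5 : (Z.weight L : ℚ) ≤ segreBound (Z + Finsupp.single P 1) * projDim L := by
        push_cast at h1
        linarith
      exact_mod_cast h5)
  exact h.add_single hP hF hFZ hFP

theorem imposesIndependentConditions_zero (d : ℕ) :
    ImposesIndependentConditions (0 : FatPointScheme K n) d :=
  fun _ => ⟨0, isHomogeneous_zero _ _ _, fun _ _ h => absurd h (by simp)⟩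

/-- The alternative `Z = 0` starts the induction for reduced schemes; monotonicity of the Segre
bound is available only for non-empty `Z`. -/
theorem regularityIndex_add_single_le (hn : 1 ≤ n) {Z : FatPointScheme K n}
    (h : Z = 0 ∨ Z.regularityIndex ≤ Z.segreBound) {P : ℙ K (Fin (n + 1) → K)}
    (hP : P ∉ Z.support) :
    regularityIndex (Z + Finsupp.single P 1) ≤ segreBound (Z + Finsupp.single P 1) := by
  rw [regularityIndex_le_iff hn]
  refine ImposesIndependentConditions.add_single_segreBound hn hP ?_
  rcases eq_or_ne Z 0 with rfl | hZ
  · exact imposesIndependentConditions_zero _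
  · have h := h.resolve_left hZ
    rw [regularityIndex_le_iff hn] at h
    exact h.mono (segreBound_mono hn hZ (by simp))

theorem eq_zero_or_regularityIndex_le_of_reduced (hn : 1 ≤ n) (X : FatPointScheme K n)
    (hX : ∀ P ∈ X.support, X P = 1) : X = 0 ∨ X.regularityIndex ≤ X.segreBound := by
  induction X using Finsupp.induction with
  | zero => exact Or.inl rfl
  | single_add P m Z hP hm ih =>
    right
    have hZP : Z P = 0 := Finsupp.notMem_support_iff.mp hP
    obtain rfl : m = 1 := by simpa [hZP, hm] using hX P
    rw [add_comm]
    refine regularityIndex_add_single_le hn (ih fun Q hQ => ?_) hP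
    have hne : P ≠ Q := fun h => hP (h ▸ hQ)
    simpa [hne, Finsupp.mem_support_iff.mp hQ] using hX Q

end FatPointScheme

theorem mainTheorem4 {K : Type*} [Field K] {n : ℕ} (hn : 1 ≤ n) :
    (∀ Z : FatPointScheme K n, Z ≠ 0 →
      Z.regularityIndex ≤ (Z.segreBound : ℕ∞) →
      ∀ P : ℙ K (Fin (n + 1) → K), P ∉ Z.support →
        FatPointScheme.regularityIndex (Z + Finsupp.single P 1) ≤
          (FatPointScheme.segreBound (Z + Finsupp.single P 1) : ℕ∞)) ∧
    (∀ X : FatPointScheme K n, X ≠ 0 → (∀ P ∈ X.support, X P = 1) →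
      X.regularityIndex ≤ (X.segreBound : ℕ∞)) :=
  ⟨fun _ _ hr _ hP => FatPointScheme.regularityIndex_add_single_le hn (Or.inr hr) hP,
    fun X hX h =>
      (FatPointScheme.eq_zero_or_regularityIndex_le_of_reduced hn X h).resolve_left hX⟩
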